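/- Let $\mathcal{A}$ be a finite set of attributes with finite domains, let $D$ be a database (a bag of tuples) over $\mathcal{A}$, and let $P, A, O \subseteq \mathcal{A}$ be pairwise disjoint sets of protected, admissible and outcome attributes. Let $G$ be an undirected graph on $\mathcal{A}$ that contains every pair of distinct attributes with non-zero mutual information in $D$ (possibly all pairs), and let $T$ be a Marginals-MST, i.e. a spanning tree of $G$. Suppose that $T$ is fair: for every way of directing each edge of $T$, all directed paths from an attribute of $P$ to an attribute of $O$ go through an attribute of $A$. Let $\vec T$ be a directed tree obtained from $T$ by directing each edge, and let $\Pr$ be a probability distribution on the tuples over $\mathcal{A}$ (the distribution of a synthetic database) that is Markov compatible with $\vec T$: whenever disjoint sets $X, Y \subseteq \mathcal{A}$ are d-separated in $\vec T$ by a set $Z$ disjoint from both, $X$ and $Y$ are conditionally independent given $Z$ under $\Pr$. Then $\Pr$ is justifiably fair, that is, $K$-fair for every $K \supseteq A$: for every protected attribute $p \in P \setminus K$, all values $a, b$ of $p$, all values $k$ of the attributes in $K$ and all values $o$ of the attributes in $O$, $$\Pr[O = o \mid do(p = a), do(K = k)] = \Pr[O = o \mid do(p = b), do(K = k)].$$ Here,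 for a set $S$ of attributes and values $s$ for them, the interventional distribution $\Pr[\,\cdot \mid do(S = s)]$ with respect to $\vec T$ gives the tuple $x$ the probability $\prod_{i \notin S} \Pr[x_i \mid x_{\mathrm{pa}(i)}]$ if $x$ agrees with $s$ on $S$, and $0$ otherwise, where $\mathrm{pa}(i)$ is the set of parents of $i$ in $\vec T$ (the edges into $S$ are removed). A conditional distribution given a parent value of probability zero may be any distribution on the domain of $i$, and the equality holds for all such choices. -/

import Mathlib

namespace FairSynth

section Graphs

variable {V : Type*}

/-- `T` is a spanning tree of `G` (both on the full attribute set `V`). -/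
def IsSpanningTree (G T : SimpleGraph V) : Prop :=
  T ≤ G ∧ T.IsTree

/-- `E` is obtained from the undirected graph `T` by giving each edge exactly one direction. -/
def IsOrientation (T : SimpleGraph V) (E : Digraph V) : Prop :=
  (∀ u v, T.Adj u v ↔ (E.Adj u v ∨ E.Adj v u)) ∧ ∀ u v, ¬ (E.Adj u v ∧ E.Adj v u)

/-- The list `l` of pairwise distinct vertices is a directed path of `E` from `u` to `v`. -/
def IsDirectedPath (E : Digraph V) (u v : V) (l : List V) : Prop :=
  l.Nodup ∧ l.IsChain E.Adj ∧ l.head? = some u ∧ l.getLast? = some v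

/-- The list `l` of pairwise distinct vertices is a path of `E` from `u` to `v` that may use
edges in either direction. -/
def IsTrail (E : Digraph V) (u v : V) (l : List V) : Prop :=
  l.Nodup ∧ l.IsChain (fun a b => E.Adj a b ∨ E.Adj b a) ∧
    l.head? = some u ∧ l.getLast? = some v

/-- `T` is fair: whichever way its edges are directed, all directed paths from an attribute of `P`
to an attribute of `O` go through an attribute of `A`. -/
def IsFairTree (T : SimpleGraph V) (P A O : Set V) : Prop :=
  ∀ E : Digraph V, IsOrientation T E →
    ∀ p ∈ P, ∀ o ∈ O, ∀ l : List V, IsDirectedPath E p o l → ∃ a ∈ A, a ∈ l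

/-- The path `l` is blocked by `Z` (Pearl): some inner vertex `b` of `l`, with neighbours `a` and
`c` on `l`, is either a collider with neither itself nor a descendant in `Z`, or a non-collider
that lies in `Z`. -/
def IsBlocked (E : Digraph V) (Z : Set V) (l : List V) : Prop :=
  ∃ a b c, [a, b, c] <:+: l ∧
    (((E.Adj a b ∧ E.Adj c b) ∧ ∀ d, Relation.ReflTransGen E.Adj b d → d ∉ Z) ∨
      (¬ (E.Adj a b ∧ E.Adj c b) ∧ b ∈ Z))

/-- `Z` d-separates `X` from `Y` in `E`. -/
def DSep (E : Digraph V) (X Y Z : Set V) : Prop :=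
  ∀ x ∈ X, ∀ y ∈ Y, ∀ l : List V, IsTrail E x y l → IsBlocked E Z l

end Graphs

section Data

variable {V : Type*} {Dom : V → Type*}

/-- Relative frequency in the database `D` (a bag of tuples) of the tuples that satisfy `c`. -/
noncomputable def freq (D : Multiset (∀ i, Dom i)) (c : (∀ i, Dom i) → Prop) : ℝ :=
  open Classical in (D.countP c : ℝ) / (D.card : ℝ)

/-- Mutual information of the attributes `i` and `j` in `D` (a term of joint frequency zero
is zero). -/
noncomputable def mutualInfo [∀ i, Fintype (Dom i)] (D : Multiset (∀ i, Dom i)) (i j : V) : ℝ :=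
  ∑ a : Dom i, ∑ b : Dom j, freq D (fun t => t i = a ∧ t j = b) *
    Real.log (freq D (fun t => t i = a ∧ t j = b) /
      (freq D (fun t => t i = a) * freq D (fun t => t j = b)))

/-- The graph whose edges are the pairs of distinct attributes with non-zero mutual information
in `D`. -/
noncomputable def mutualInfoGraph [∀ i, Fintype (Dom i)] (D : Multiset (∀ i, Dom i)) :
    SimpleGraph V :=
  SimpleGraph.fromRel (fun i j => mutualInfo D i j ≠ 0)

end Data

section Distributions

variable {V : Type*} [Fintype V] [DecidableEq V] {Dom : V → Type*} [∀ i, Fintype (Dom i)]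

/-- The probability under `μ` that the attributes in `S` take the values that they have in `v`. -/
noncomputable def marg (μ : PMF (∀ i, Dom i)) (S : Set V) (v : ∀ i, Dom i) : ENNReal :=
  open Classical in ∑ w : (∀ i, Dom i), if ∀ i ∈ S, w i = v i then μ w else 0

/-- Under `μ`, the attributes in `X` and those in `Y` are conditionally independent given those
in `Z` : `P(x, y, z) P(z) = P(x, z) P(y, z)` for all values. -/
def CondIndep (μ : PMF (∀ i, Dom i)) (X Y Z : Set V) : Prop :=
  ∀ v : (∀ i, Dom i),
    marg μ (X ∪ Y ∪ Z) v * marg μ Z v = marg μ (X ∪ Z) v * marg μ (Y ∪ Z) v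

/-- `μ` is Markov compatible with `E`: d-separation implies conditional independence. -/
def MarkovCompatible (μ : PMF (∀ i, Dom i)) (E : Digraph V) : Prop :=
  ∀ X Y Z : Set V, Disjoint X Y → Disjoint X Z → Disjoint Y Z →
    DSep E X Y Z → CondIndep μ X Y Z

/-- A table of distributions of each attribute, one for each value of its parents in `E`. -/
abbrev CondTables (E : Digraph V) (Dom : V → Type*) :=
  ∀ i : V, (∀ j : {j : V // E.Adj j i}, Dom j) → PMF (Dom i)

/-- `q` gives the conditional distributions, under `μ`, of each attribute given its parents in `E`:
`q(x | pa) P(pa) = P(x, pa)`. Where `P(pa) > 0` this determines `q`; a conditional distribution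
given an event of probability zero is arbitrary. -/
def IsConditional (μ : PMF (∀ i, Dom i)) (E : Digraph V) (q : CondTables E Dom) : Prop :=
  ∀ (i : V) (v : ∀ i, Dom i),
    q i (fun j => v j) (v i) * marg μ {j | E.Adj j i} v = marg μ (insert i {j | E.Adj j i}) v

/-- The probability of the tuple `v` under the intervention that sets the attributes in `S` to
their values in `s`: the edges into `S` are removed, those attributes are held constant, and every
other attribute keeps its conditional distribution given its parents. -/
noncomputable def doProb {E : Digraph V} (q : CondTables E Dom) (S : Set V) (s v : ∀ i, Dom i) :
    ENNReal :=
  open Classical in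
  if ∀ i ∈ S, v i = s i then ∏ i : V, (if i ∈ S then 1 else q i (fun j => v j) (v i)) else 0

/-- The probability, under that intervention, that the attributes in `O` take the values that they
have in `o`. -/
noncomputable def doMarg {E : Digraph V} (q : CondTables E Dom) (S : Set V) (s : ∀ i, Dom i)
    (O : Set V) (o : ∀ i, Dom i) : ENNReal :=
  open Classical in ∑ v : (∀ i, Dom i), if ∀ i ∈ O, v i = o i then doProb q S s v else 0

/-- `K`-fairness: for all values `k` of `K`, `o` of `O`, and `a`, `b` of a protected attribute `p`,
`P(O = o | do(p = a), do(K = k)) = P(O = o | do(p = b), do(K = k))`. It is required for all versions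
of the conditional distributions of `μ`. A clause with `p ∈ K` would intervene twice on the same
attribute and is not considered. -/
def KFair (μ : PMF (∀ i, Dom i)) (E : Digraph V) (P O K : Set V) : Prop :=
  ∀ q : CondTables E Dom, IsConditional μ E q →
    ∀ p ∈ P, p ∉ K → ∀ (k o : ∀ i, Dom i) (a b : Dom p),
      doMarg q (insert p K) (Function.update k p a) O o =
        doMarg q (insert p K) (Function.update k p b) O o

/-- Justifiable fairness: `K`-fairness for all `K ⊇ A`. -/
def JustifiablyFair (μ : PMF (∀ i, Dom i)) (E : Digraph V) (P A O : Set V) : Prop :=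
  ∀ K : Set V, A ⊆ K → KFair μ E P O K

/-- Conditional distributions always exist, so that the quantifier over them in `KFair` is never
empty. -/
theorem exists_isConditional (μ : PMF (∀ i, Dom i)) (E : Digraph V) :
    ∃ q : CondTables E Dom, IsConditional μ E q := by
  classical
  have hne : Nonempty (∀ i, Dom i) := ⟨μ.support_nonempty.some⟩
  have key : ∀ (i : V) (u : ∀ j : {j : V // E.Adj j i}, Dom j), ∃ r : PMF (Dom i),
      ∀ v : (∀ i, Dom i), (fun j : {j : V // E.Adj j i} => v j) = u →
        r (v i) * marg μ {j | E.Adj j i} v = marg μ (insert i {j | E.Adj j i}) v := by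
    intro i u
    let s : Set (∀ i, Dom i) := {w | ∀ j : {j : V // E.Adj j i}, w j = u j}
    have hm : ∀ v : (∀ i, Dom i), (fun j : {j : V // E.Adj j i} => v j) = u →
        marg μ {j | E.Adj j i} v = ∑ w, s.indicator μ w := by
      rintro v rfl
      refine Finset.sum_congr rfl fun w _ => ?_
      simp [Set.indicator_apply, s]
    by_cases h : ∃ a ∈ s, a ∈ μ.support
    · refine ⟨(μ.filter s h).map (fun w => w i), fun v hv => ?_⟩
      have hm' := hm v hv
      have h0 : (∑ w, s.indicator μ w) ≠ 0 := by
        obtain ⟨a, ha, ha'⟩ := h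
        intro h0
        have := (Finset.sum_eq_zero_iff.1 h0) a (Finset.mem_univ _)
        rw [Set.indicator_of_mem ha] at this
        exact ha' this
      have ht : (∑ w, s.indicator μ w) ≠ ⊤ := by
        refine ENNReal.sum_ne_top.2 fun w _ => ?_
        rw [Set.indicator_apply]
        split_ifs
        · exact μ.apply_ne_top w
        · simp
      rw [hm', PMF.map_apply, tsum_fintype, Finset.sum_mul]
      subst hv
      refine Finset.sum_congr rfl fun w _ => ?_
      rw [PMF.filter_apply, tsum_fintype]
      by_cases h1 : v i = w i
      · rw [if_pos h1, mul_assoc, ENNReal.inv_mul_cancel h0 ht, mul_one]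
        simp [Set.indicator_apply, s, h1]
      · have : ¬ w i = v i := fun h => h1 h.symm
        simp [h1, this]
    · push Not at h
      refine ⟨PMF.pure (hne.some i), fun v hv => ?_⟩
      have hz : ∀ w ∈ s, μ w = 0 := fun w hw => by simpa using h w hw
      have h1 : marg μ {j | E.Adj j i} v = 0 := by
        rw [hm v hv]
        refine Finset.sum_eq_zero fun w _ => ?_
        rw [Set.indicator_apply]
        split_ifs with hw
        · exact hz w hw
        · rfl
      rw [h1, mul_zero]
      symm
      subst hv
      refine Finset.sum_eq_zero fun w _ => ?_
      split_ifs with hw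
      · exact hz w fun j => hw j (Set.mem_insert_of_mem _ j.2)
      · rfl
  choose r hr using key
  exact ⟨r, fun i v => hr i _ v rfl⟩

end Distributions

end FairSynth

/-!
The argument works with the truncated product itself, for an arbitrary table `q` of conditional
distributions, so that parent values of probability zero need no separate treatment.

Let `R` be the set of attributes that `p` reaches by directed paths whose later vertices avoid `K`.
An orientation of a tree has no directed cycle (`not_transGen_self_of_isOrientation`), so such a
path is a path in the sense of `IsDirectedPath`; fairness, applied to the given orientation, then
shows that `R` does not meet `O` (`disjoint_of_forall_isDirectedPath`). An attribute outside
`R ∪ K` has no parent in `R`, so in the sum defining `P(O = o | do(p = a), do(K = k))` the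
attributes in `R` occur only in their own factors: the indicator of `v p = a` and the conditional
distributions of the rest of `R`. Summing these out, children before parents
(`sum_mul_prod_eq_sum_mul_prod_indicator`), removes all dependence on `a`.
-/

open Relation

namespace FairSynth

/-! ### Orientations of trees -/

section Graphs

variable {V : Type*}

/-- If `v → w` is the first edge of a directed cycle, the rest of the cycle connects `w` to `v`
without the edge `vw`, although every edge of a forest is a bridge. -/
theorem not_transGen_self_of_isOrientation {T : SimpleGraph V} {E : Digraph V}
    (hT : T.IsAcyclic) (hE : IsOrientation T E) (v : V) : ¬ TransGen E.Adj v v := by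
  intro h
  obtain ⟨w, hvw, hwv⟩ := TransGen.head'_iff.1 h
  have hadj : T.Adj v w := (hE.1 v w).2 (Or.inl hvw)
  have hbridge := SimpleGraph.isAcyclic_iff_forall_adj_isBridge.1 hT hadj
  have key : ∀ u, ReflTransGen E.Adj w u → (T.deleteEdges {s(v, w)}).Reachable w u := by
    intro u hu
    induction hu with
    | refl => exact SimpleGraph.Reachable.refl _
    | @tail x y _ hxy ih =>
      by_cases he : s(x, y) = s(v, w)
      · rcases Sym2.eq_iff.1 he with ⟨rfl, rfl⟩ | ⟨rfl, rfl⟩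
        · exact SimpleGraph.Reachable.refl _
        · exact absurd ⟨hvw, hxy⟩ (hE.2 _ _)
      · refine ih.trans (SimpleGraph.Adj.reachable ?_)
        rw [SimpleGraph.deleteEdges_adj]
        exact ⟨(hE.1 x y).2 (Or.inl hxy), he⟩
  exact (SimpleGraph.isBridge_iff.1 hbridge) (key v hwv).symm

/-- The vertices that `p` reaches in `E` by directed paths all of whose vertices, except possibly
`p` itself, lie outside `K`. -/
def reachAvoiding (E : Digraph V) (K : Set V) (p : V) : Set V :=
  {i | ReflTransGen (fun x y => E.Adj x y ∧ y ∉ K) p i}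

theorem notMem_of_mem_reachAvoiding {E : Digraph V} {K : Set V} {p i : V} (hp : p ∉ K)
    (hi : i ∈ reachAvoiding E K p) : i ∉ K := by
  rcases ReflTransGen.cases_tail hi with rfl | ⟨_, _, h⟩
  · exact hp
  · exact h.2

/-- If every directed path from `p` to `O` meets a subset `A` of `K`, then `p` cannot reach `O`
while avoiding `K`. Acyclicity ensures that the vertices of a directed walk are distinct. -/
theorem disjoint_of_forall_isDirectedPath {E : Digraph V} (hac : ∀ v, ¬ TransGen E.Adj v v)
    {A O K : Set V} {p : V} (hAK : A ⊆ K) (hp : p ∉ K)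
    (h : ∀ o ∈ O, ∀ l : List V, IsDirectedPath E p o l → ∃ a ∈ A, a ∈ l) :
    Disjoint (reachAvoiding E K p) O := by
  rw [Set.disjoint_left]
  intro o ho hoO
  obtain ⟨l, hchain, hlast⟩ := List.exists_isChain_cons_of_relationReflTransGen ho
  have hE : (p :: l).IsChain E.Adj := hchain.imp fun _ _ h => h.1
  have hnodup : (p :: l).Nodup := by
    have : (p :: l).Pairwise (TransGen E.Adj) :=
      List.isChain_iff_pairwise.1 (hE.imp fun _ _ h => TransGen.single h)
    refine this.imp fun {x y} hxy (hne : x = y) => hac x ?_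
    rwa [← hne] at hxy
  obtain ⟨a, haA, hal⟩ := h o hoO (p :: l)
    ⟨hnodup, hE, rfl, by rw [List.getLast?_eq_some_getLast (List.cons_ne_nil _ _), hlast]⟩
  have hmem : ∀ x ∈ p :: l, x ∈ reachAvoiding E K p :=
    List.IsChain.induction (reachAvoiding E K p) _ hchain
      (fun _ _ hxy hx => ReflTransGen.tail hx hxy) (fun _ => ReflTransGen.refl)
  exact notMem_of_mem_reachAvoiding hp (hmem a hal) (hAK haA)

/-- A nonempty finite set of vertices of a finite acyclic digraph has a vertex with no child in the
set. -/
theorem exists_forall_not_adj [Finite V] {E : Digraph V} (hac : ∀ v, ¬ TransGen E.Adj v v)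
    {W : Finset V} (hW : W.Nonempty) : ∃ w ∈ W, ∀ i ∈ W, ¬ E.Adj w i := by
  have : IsTrans V (Function.swap (TransGen E.Adj)) := ⟨fun _ _ _ h₁ h₂ => h₂.trans h₁⟩
  have : Std.Irrefl (Function.swap (TransGen E.Adj)) := ⟨hac⟩
  have hwf := Finite.wellFounded_of_trans_of_irrefl (Function.swap (TransGen E.Adj))
  obtain ⟨w, hw, hmin⟩ := hwf.has_min (W : Set V) hW
  exact ⟨w, hw, fun i hi h => hmin i hi (TransGen.single h)⟩

end Graphs

/-! ### Summing out coordinates -/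

section Sums

variable {V : Type*} [Fintype V] [DecidableEq V] {Dom : V → Type*} [∀ i, Fintype (Dom i)]

/-- A sum over all tuples can be carried out over the coordinate `w` first, and a factor that does
not depend on that coordinate moves out of the inner sum. -/
theorem sum_mul_congr_of_sum_update_eq (w : V) (h r r' : (∀ i, Dom i) → ENNReal)
    (hh : ∀ v x, h (Function.update v w x) = h v)
    (hr : ∀ v, ∑ x, r (Function.update v w x) = ∑ x, r' (Function.update v w x)) :
    ∑ v, h v * r v = ∑ v, h v * r' v := by
  have hupd : ∀ (x x' : Dom w) (y : ∀ j : {j // j ≠ w}, Dom j),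
      Function.update ((Equiv.piSplitAt w Dom).symm (x, y)) w x' =
        (Equiv.piSplitAt w Dom).symm (x', y) := by
    intro x x' y
    funext j
    by_cases hj : j = w
    · subst hj; simp [Equiv.piSplitAt]
    · simp [Equiv.piSplitAt, hj]
  rw [← (Equiv.piSplitAt w Dom).symm.sum_comp, ← (Equiv.piSplitAt w Dom).symm.sum_comp,
    Fintype.sum_prod_type_right, Fintype.sum_prod_type_right]
  refine Finset.sum_congr rfl fun y _ => ?_
  rcases isEmpty_or_nonempty (Dom w) with _ | ⟨⟨x₀⟩⟩
  · simp
  · have hconst : ∀ x, h ((Equiv.piSplitAt w Dom).symm (x, y)) =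
        h ((Equiv.piSplitAt w Dom).symm (x₀, y)) := fun x => by rw [← hupd x₀ x y, hh]
    simp_rw [hconst, ← Finset.mul_sum]
    have := hr ((Equiv.piSplitAt w Dom).symm (x₀, y))
    simp_rw [hupd] at this
    rw [this]

/-- Each `r i` stands for a conditional distribution of `i` given its parents, and `f` does not
depend on the coordinates in `W`. These distributions may then be replaced by point masses at an
arbitrary tuple `c`, a normal form in which the `r i` no longer occur. -/
theorem sum_mul_prod_eq_sum_mul_prod_indicator {E : Digraph V}
    (hac : ∀ v, ¬ TransGen E.Adj v v) (c : ∀ i, Dom i) (r : V → (∀ i, Dom i) → ENNReal)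
    [∀ i, DecidableEq (Dom i)]
    (hsum : ∀ i v, ∑ x, r i (Function.update v i x) = 1)
    (hloc : ∀ i j, j ≠ i → ¬ E.Adj j i → ∀ v x, r i (Function.update v j x) = r i v)
    (W : Finset V) (f : (∀ i, Dom i) → ENNReal)
    (hf : ∀ i ∈ W, ∀ v x, f (Function.update v i x) = f v) :
    ∑ v, f v * ∏ i ∈ W, r i v = ∑ v, f v * ∏ i ∈ W, if v i = c i then 1 else 0 := by
  induction hn : W.card generalizing W f with
  | zero =>
    obtain rfl := Finset.card_eq_zero.1 hn
    simp
  | succ n ih =>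
    obtain ⟨w, hw, hsink⟩ := exists_forall_not_adj hac
      (Finset.card_pos.1 (by omega : 0 < W.card))
    have hstep : ∑ v, (f v * ∏ i ∈ W.erase w, r i v) * r w v =
        ∑ v, (f v * ∏ i ∈ W.erase w, r i v) * if v w = c w then 1 else 0 := by
      refine sum_mul_congr_of_sum_update_eq w _ _ _ (fun v x => ?_) (fun v => ?_)
      · rw [hf w hw]
        congr 1
        refine Finset.prod_congr rfl fun i hi => ?_
        obtain ⟨hiw, hiW⟩ := Finset.mem_erase.1 hi
        exact hloc i w hiw.symm (hsink i hiW) v x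
      · rw [hsum]
        simp
    have hih := ih (W.erase w) (fun v => f v * if v w = c w then 1 else 0)
      (fun i hi v x => by
        obtain ⟨hiw, hiW⟩ := Finset.mem_erase.1 hi
        rw [hf i hiW, Function.update_of_ne hiw.symm])
      (by rw [Finset.card_erase_of_mem hw, hn]; rfl)
    calc ∑ v, f v * ∏ i ∈ W, r i v
        = ∑ v, (f v * ∏ i ∈ W.erase w, r i v) * r w v := by
          refine Finset.sum_congr rfl fun v _ => ?_
          rw [mul_assoc, Finset.prod_erase_mul _ _ hw]
      _ = ∑ v, (f v * if v w = c w then 1 else 0) * ∏ i ∈ W.erase w, r i v := by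
          rw [hstep]
          exact Finset.sum_congr rfl fun v _ => mul_right_comm _ _ _
      _ = _ := by
          rw [hih]
          refine Finset.sum_congr rfl fun v _ => ?_
          rw [mul_assoc,
            Finset.mul_prod_erase W (fun i => if v i = c i then (1 : ENNReal) else 0) hw]

end Sums

/-! ### Interventions -/

section Interventions

variable {V : Type*} [DecidableEq V] {Dom : V → Type*}

open Classical in
/-- The factor of the attribute `i` under the intervention that sets `p` to `a`: a point mass for
`p`, and the given conditional distribution otherwise. -/
noncomputable def doFactor {E : Digraph V} (q : CondTables E Dom) (p : V) (a : Dom p) (i : V)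
    (v : ∀ i, Dom i) : ENNReal :=
  if i = p then if v p = a then 1 else 0 else q i (fun j => v j) (v i)

theorem sum_doFactor_update [∀ i, Fintype (Dom i)] {E : Digraph V} (hirr : ∀ v, ¬ E.Adj v v)
    (q : CondTables E Dom) (p : V) (a : Dom p) (i : V) (v : ∀ i, Dom i) :
    ∑ x, doFactor q p a i (Function.update v i x) = 1 := by
  classical
  by_cases hi : i = p
  · subst hi
    simp [doFactor]
  · have hpa : ∀ x, (fun j : {j // E.Adj j i} => Function.update v i x j) =
        fun j : {j // E.Adj j i} => v j := by
      intro x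
      funext j
      exact Function.update_of_ne (fun h => hirr i (by simpa [h] using j.2)) _ _
    simp only [doFactor, if_neg hi, hpa, Function.update_self]
    rw [← (q i fun j => v j).tsum_coe, tsum_fintype]

theorem condTables_update {E : Digraph V} (q : CondTables E Dom) {i j : V} (hji : j ≠ i)
    (h : ¬ E.Adj j i) (v : ∀ i, Dom i) (x : Dom j) :
    q i (fun m => Function.update v j x m) (Function.update v j x i) =
      q i (fun m => v m) (v i) := by
  have hpa : (fun m : {m // E.Adj m i} => Function.update v j x m) =
      fun m : {m // E.Adj m i} => v m := by
    funext m
    exact Function.update_of_ne (fun hm => h (by simpa [← hm] using m.2)) _ _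
  rw [hpa, Function.update_of_ne hji.symm]

theorem doFactor_update {E : Digraph V} (q : CondTables E Dom) (p : V) (a : Dom p) (i j : V)
    (hji : j ≠ i) (h : ¬ E.Adj j i) (v : ∀ i, Dom i) (x : Dom j) :
    doFactor q p a i (Function.update v j x) = doFactor q p a i v := by
  classical
  by_cases hi : i = p
  · subst hi
    simp only [doFactor, if_true]
    exact if_congr (by rw [Function.update_of_ne hji.symm]) rfl rfl
  · simp only [doFactor, if_neg hi]
    exact condTables_update q hji h v x

open Classical in
/-- The part of the truncated product that belongs to the attributes outside `R`, together with the
constraints on `O` and `K`. -/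
noncomputable def outerFactor [Fintype V] {E : Digraph V} (q : CondTables E Dom) (R K O : Set V)
    (k o v : ∀ i, Dom i) : ENNReal :=
  if (∀ i ∈ O, v i = o i) ∧ ∀ i ∈ K, v i = k i then
    ∏ i with i ∉ R, if i ∈ K then 1 else q i (fun j => v j) (v i)
  else 0

/-- As an attribute outside `R ∪ K` has no parent in `R`, the outer part does not depend on the
coordinates in `R`. -/
theorem outerFactor_update [Fintype V] {E : Digraph V} (q : CondTables E Dom) {R K O : Set V}
    (hRO : Disjoint R O) (hRK : Disjoint R K)
    (hclosed : ∀ i j, j ∈ R → E.Adj j i → i ∉ K → i ∈ R) (k o : ∀ i, Dom i)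
    {j : V} (hj : j ∈ R) (v : ∀ i, Dom i) (x : Dom j) :
    outerFactor q R K O k o (Function.update v j x) = outerFactor q R K O k o v := by
  classical
  have hne : ∀ {S : Set V}, Disjoint R S → ∀ i ∈ S, i ≠ j := fun hS i hi hij =>
    Set.disjoint_left.1 hS hj (hij ▸ hi)
  have hcond : ∀ {S : Set V}, Disjoint R S → ∀ s : (∀ i, Dom i),
      (∀ i ∈ S, Function.update v j x i = s i) ↔ ∀ i ∈ S, v i = s i := fun hS s =>
    forall₂_congr fun i hi => by rw [Function.update_of_ne (hne hS i hi)]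
  simp only [outerFactor, hcond hRO, hcond hRK]
  refine if_congr Iff.rfl (Finset.prod_congr rfl fun i hi => ?_) rfl
  have hiR : i ∉ R := (Finset.mem_filter.1 hi).2
  by_cases hiK : i ∈ K
  · simp only [if_pos hiK]
  · simp only [if_neg hiK]
    exact condTables_update q (fun h : j = i => hiR (h ▸ hj))
      (fun h => hiR (hclosed i j hj h hiK)) v x

open Classical in
/-- The truncated product, split into the factors of the attributes in `R`, which absorb the
constraint `v p = a`, and all the rest, in which `a` does not occur. -/
theorem doMarg_eq_sum_outerFactor_mul_prod [Fintype V] [∀ i, Fintype (Dom i)] {E : Digraph V}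
    (q : CondTables E Dom) {R K : Set V} (O : Set V) {p : V} (hpR : p ∈ R) (hRK : Disjoint R K)
    (k o : ∀ i, Dom i) (a : Dom p) :
    doMarg q (insert p K) (Function.update k p a) O o =
      ∑ v, outerFactor q R K O k o v * ∏ i with i ∈ R, doFactor q p a i v := by
  have hpK : p ∉ K := Set.disjoint_left.1 hRK hpR
  refine Finset.sum_congr rfl fun v _ => ?_
  have hcond : (∀ i ∈ insert p K, v i = Function.update k p a i) ↔
      v p = a ∧ ∀ i ∈ K, v i = k i := by
    rw [Set.forall_mem_insert, Function.update_self]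
    refine and_congr_right fun _ => forall₂_congr fun i hi => ?_
    rw [Function.update_of_ne (fun h : i = p => hpK (h ▸ hi))]
  simp only [doProb, hcond, outerFactor]
  by_cases hO : ∀ i ∈ O, v i = o i
  swap
  · simp [hO]
  by_cases hK : ∀ i ∈ K, v i = k i
  swap
  · simp [hK]
  by_cases ha : v p = a
  swap
  · have : ∏ i with i ∈ R, doFactor q p a i v = 0 :=
      Finset.prod_eq_zero (i := p) (by simpa using hpR) (by simp [doFactor, ha])
    simp [this, ha]
  rw [if_pos hO, if_pos ⟨ha, hK⟩, if_pos ⟨hO, hK⟩,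
    ← Finset.prod_filter_not_mul_prod_filter _ (fun i => i ∈ R)]
  congr 1
  · refine Finset.prod_congr rfl fun i hi => ?_
    have hip : i ≠ p := fun h : i = p => (Finset.mem_filter.1 hi).2 (h ▸ hpR)
    simp [hip]
  · refine Finset.prod_congr rfl fun i hi => ?_
    have hiK : i ∉ K := Set.disjoint_left.1 hRK (Finset.mem_filter.1 hi).2
    by_cases hip : i = p
    · subst hip
      simp [doFactor, ha]
    · simp [doFactor, hip, hiK]

end Interventions

end FairSynth

theorem proposition2 {V : Type*} [Fintype V] [DecidableEq V]
    {Dom : V → Type*} [∀ i, Fintype (Dom i)]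
    -- the database, its graph of candidate edges (all pairs of non-zero mutual information, and
    -- possibly more), and disjoint sets of protected, admissible and outcome attributes
    (D : Multiset (∀ i, Dom i)) (G : SimpleGraph V) (hG : FairSynth.mutualInfoGraph D ≤ G)
    (P A O : Set V) (hPA : Disjoint P A) (hPO : Disjoint P O) (hAO : Disjoint A O)
    -- a fair Marginals-MST, and a directed tree obtained from it
    (T : SimpleGraph V) (hT : FairSynth.IsSpanningTree G T) (hfair : FairSynth.IsFairTree T P A O)
    (E : Digraph V) (hE : FairSynth.IsOrientation T E)
    -- the distribution of the synthetic database
    (μ : PMF (∀ i, Dom i)) (hμ : FairSynth.MarkovCompatible μ E) :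
    FairSynth.JustifiablyFair μ E P A O := by
  classical
  intro K hAK q _ p hp hpK k o a b
  have hac := FairSynth.not_transGen_self_of_isOrientation hT.2.isAcyclic hE
  have hRO := FairSynth.disjoint_of_forall_isDirectedPath hac hAK hpK (hfair E hE p hp)
  have hRK : Disjoint (FairSynth.reachAvoiding E K p) K :=
    Set.disjoint_left.2 fun _ hi => FairSynth.notMem_of_mem_reachAvoiding hpK hi
  have hpR : p ∈ FairSynth.reachAvoiding E K p := ReflTransGen.refl
  -- Both sides equal the sum in which all of `R`, including `p`, is fixed to its values in `k`.
  have key := fun c => FairSynth.sum_mul_prod_eq_sum_mul_prod_indicator hac k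
    (FairSynth.doFactor q p c)
    (FairSynth.sum_doFactor_update (fun v h => hac v (TransGen.single h)) q p c)
    (FairSynth.doFactor_update q p c)
    {i | i ∈ FairSynth.reachAvoiding E K p}
    (FairSynth.outerFactor q (FairSynth.reachAvoiding E K p) K O k o)
    (fun i hi => FairSynth.outerFactor_update q hRO hRK
      (fun i j hj hji hiK => ReflTransGen.tail hj ⟨hji, hiK⟩) k o (by simpa using hi))
  rw [FairSynth.doMarg_eq_sum_outerFactor_mul_prod q O hpR hRK,
    FairSynth.doMarg_eq_sum_outerFactor_mul_prod q O hpR hRK, key a, key b]
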